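/- Let $X$ be a finite-dimensional real Hilbert space, $f:X\to X$, $J:X\to\mathbb R$ (a parameter of the system is held fixed and suppressed), and let $\Lambda\subset X$ be a compact set that is invariant under the flow of $\dot u=f(u)$ (for example a compact attractor). Assume that $f$ and $J$ are differentiable at the points of $\Lambda$, with derivative $f_u$ and gradient $J_u$ continuous on $\Lambda$, and that the flow is uniformly hyperbolic on $\Lambda$: $f\neq0$ on $\Lambda$; for each $x\in\Lambda$ there is a splitting $X=E^+(x)\oplus\mathbb R f(x)\oplus E^-(x)$; $E^{\pm}$ are invariant under the linearized equation $\dot v=f_u(u(t))\,v$ along every trajectory $u$ in $\Lambda$; and there are constants $C,\mu>0$ such that, for every such $u$ and $v$ and every $\tau\ge 0$, $\|v(\tau)\|\le Ce^{-\mu\tau}\|v(0)\|$ if $v(0)\in E^-(u(0))$, and $\|v(0)\|\le Ce^{-\mu\tau}\|v(\tau)\|$ if $v(0)\in E^+(u(0))$. The unstable, neutral and stable adjoint subspaces at $x$ are $(\mathbb Rf(x)\oplus E^-(x))^\perp$, $(E^+(x)\oplus E^-(x))^\perp$ and $(E^+(x)\oplus\mathbb Rf(x))^\perp$; their direct sum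 is $X$. Let $u:[0,\infty)\to\Lambda$ be a trajectory, write $f(t)=f(u(t))$, $J(t)=J(u(t))$, and suppose that the limit $\bar J=\lim_{T\to\infty}\frac1T\int_0^TJ(t)\,dt$ exists. Let $\psi^\infty$ be the adjoint shadowing direction along $u$, that is, a solution on $[0,\infty)$ of the adjoint equation $$\frac{d\psi}{dt}+f_u(u(t))^*\psi+J_u(u(t))=0\qquad(\ast)$$ that is bounded, whose component in the unstable adjoint subspace at $u(0)$ vanishes at $t=0$, and for which $\lim_{T\to\infty}\frac1T\int_0^T\langle\psi^\infty(t),f(t)\rangle\,dt=0$. For each $T>0$ let $\psi_T$ be a solution of $(\ast)$ on $[0,T]$ such that $\langle\psi_T(T),f(T)\rangle=\bar J-J(T)$, and suppose that there is a constant $\delta<\infty$ independent of $T$ with $\|\psi_T(0)\|<\delta$ and $\|\psi_T(T)\|<\delta$ for all $T>0$. Put $e_T=\psi_T-\psi^\infty$ on $[0,T]$. Then there is a real constant $M>0$, independent of $T$, such that $$\|e_T\|_{H^1(0,T)}^2=\int_0^T\|e_T\|^2\,dt+\int_0^T\Big\|\frac{de_T}{dt}\Big\|^2dt<M\qquad\text{for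 all }T>0.$$ In particular, $\limsup_{T\to\infty}\|e_T\|_{H^1(0,T)}<\infty$. -/

import Mathlib

open Set Filter Topology MeasureTheory
open scoped ENNReal InnerProductSpace Gradient

/-- A forward trajectory of `du/dt = f(u)` that stays in `Λ`; only its values on `[0, ∞)` matter. -/
def IsTrajectory {X : Type*} [NormedAddCommGroup X] [InnerProductSpace ℝ X]
    (f : X → X) (Λ : Set X) (u : ℝ → X) : Prop :=
  ∀ t ∈ Ici (0 : ℝ), u t ∈ Λ ∧ HasDerivWithinAt u (f (u t)) (Ici 0) t

/-- `Λ` is invariant under the flow: through each point of `Λ` there passes a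
complete trajectory (defined for all times in `ℝ`) that lies in `Λ`. -/
def IsFlowInvariant {X : Type*} [NormedAddCommGroup X] [InnerProductSpace ℝ X]
    (f : X → X) (Λ : Set X) : Prop :=
  ∀ x ∈ Λ, ∃ u : ℝ → X, u 0 = x ∧ ∀ t : ℝ, u t ∈ Λ ∧ HasDerivAt u (f (u t)) t

/-- `v` solves the linearized (tangent) equation `dv/dt = f_u(u(t)) v` on `[0, τ]`, so that
`v τ` is the image of `v 0` under the derivative of the time-`τ` flow map at `u 0`. -/
def IsTangentSolution {X : Type*} [NormedAddCommGroup X] [InnerProductSpace ℝ X]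
    (f : X → X) (u v : ℝ → X) (τ : ℝ) : Prop :=
  ∀ t ∈ Icc 0 τ, HasDerivWithinAt v (fderiv ℝ f (u t) (v t)) (Icc 0 τ) t

/-- `E` is invariant under the tangent dynamics over `Λ`: the derivative of the flow maps
`E (u 0)` onto `E (u τ)`. -/
def IsTangentInvariant {X : Type*} [NormedAddCommGroup X] [InnerProductSpace ℝ X]
    (f : X → X) (Λ : Set X) (E : X → Submodule ℝ X) : Prop :=
  ∀ u : ℝ → X, IsTrajectory f Λ u → ∀ τ : ℝ, 0 ≤ τ → ∀ v : ℝ → X,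
    IsTangentSolution f u v τ → (v 0 ∈ E (u 0) ↔ v τ ∈ E (u τ))

/-- The compact set `Λ` is a uniformly hyperbolic set of the flow of `f`, with unstable
subspaces `Eu x`, stable subspaces `Es x` and one-dimensional neutral subspaces `ℝ f(x)`. -/
structure IsUniformlyHyperbolic {X : Type*} [NormedAddCommGroup X] [InnerProductSpace ℝ X]
    (f : X → X) (Λ : Set X) (Eu Es : X → Submodule ℝ X) : Prop where
  isCompact : IsCompact Λ
  invariant : IsFlowInvariant f Λ
  ne_zero : ∀ x ∈ Λ, f x ≠ 0
  splitting : ∀ x ∈ Λ, DirectSum.IsInternal ![Eu x, Submodule.span ℝ {f x}, Es x]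
  unstable_invariant : IsTangentInvariant f Λ Eu
  stable_invariant : IsTangentInvariant f Λ Es
  /-- Stable vectors decay exponentially in forward time and unstable vectors decay
  exponentially in backward time, with constants that are uniform over `Λ`. -/
  rates : ∃ C μ : ℝ, 0 < C ∧ 0 < μ ∧
    ∀ u : ℝ → X, IsTrajectory f Λ u → ∀ τ : ℝ, 0 ≤ τ → ∀ v : ℝ → X,
      IsTangentSolution f u v τ →
        (v 0 ∈ Es (u 0) → ‖v τ‖ ≤ C * Real.exp (-μ * τ) * ‖v 0‖) ∧
        (v 0 ∈ Eu (u 0) → ‖v 0‖ ≤ C * Real.exp (-μ * τ) * ‖v τ‖)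

/-- `w = wp + w0 + wm` is the splitting of `w` into its components in the unstable, neutral and
stable adjoint subspaces at `x`. The adjoint subspaces form the splitting that is dual
(biorthogonal) to `X = Eu x ⊕ ℝ f(x) ⊕ Es x`. -/
structure IsAdjointSplitting {X : Type*} [NormedAddCommGroup X] [InnerProductSpace ℝ X]
    (f : X → X) (Eu Es : X → Submodule ℝ X) (x w wp w0 wm : X) : Prop where
  unstable_mem : wp ∈ (Submodule.span ℝ {f x} ⊔ Es x)ᗮ
  neutral_mem : w0 ∈ (Eu x ⊔ Es x)ᗮ
  stable_mem : wm ∈ (Eu x ⊔ Submodule.span ℝ {f x})ᗮ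
  eq_add : w = wp + w0 + wm

/-- `ψ` solves the adjoint equation `dψ/dt + f_u^* ψ + J_u = 0` along `u` on the interval `I`. -/
def IsAdjointSolution {X : Type*} [NormedAddCommGroup X] [InnerProductSpace ℝ X]
    [CompleteSpace X] (f : X → X) (J : X → ℝ) (u ψ : ℝ → X) (I : Set ℝ) : Prop :=
  ∀ t ∈ I, ∃ ψ' : X, HasDerivWithinAt ψ ψ' I t ∧
    ψ' + ContinuousLinearMap.adjoint (fderiv ℝ f (u t)) (ψ t) + ∇ J (u t) = 0

/-- The adjoint shadowing direction along `u`: a bounded adjoint solution on `[0, ∞)` whose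
unstable component vanishes at time `0` and for which the long-time average of `⟪ψ, f⟫` is `0`. -/
structure IsAdjointShadowingDirection {X : Type*} [NormedAddCommGroup X]
    [InnerProductSpace ℝ X] [CompleteSpace X] (f : X → X) (J : X → ℝ)
    (Eu Es : X → Submodule ℝ X) (u ψ : ℝ → X) : Prop where
  adjoint : IsAdjointSolution f J u ψ (Ici 0)
  bounded : ∃ B : ℝ, ∀ t ∈ Ici (0 : ℝ), ‖ψ t‖ ≤ B
  unstable_zero : ∃ w0 wm : X, IsAdjointSplitting f Eu Es (u 0) (ψ 0) 0 w0 wm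
  average_zero : Tendsto (fun T : ℝ => (1 / T) * ∫ t in (0 : ℝ)..T, ⟪ψ t, f (u t)⟫_ℝ)
    atTop (𝓝 0)

/-- For each `T > 0`, `ψ T` is an adjoint solution on `[0, T]` with
`⟪ψ_T(T), f(T)⟫ = Jbar - J(T)` and with boundary values bounded by `δ` independently of `T`. -/
structure IsFiniteTimeAdjointFamily {X : Type*} [NormedAddCommGroup X]
    [InnerProductSpace ℝ X] [CompleteSpace X] (f : X → X) (J : X → ℝ) (Jbar : ℝ)
    (u : ℝ → X) (δ : ℝ) (ψ : ℝ → ℝ → X) : Prop where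
  adjoint : ∀ T : ℝ, 0 < T → IsAdjointSolution f J u (ψ T) (Icc 0 T)
  terminal : ∀ T : ℝ, 0 < T → ⟪ψ T T, f (u T)⟫_ℝ = Jbar - J (u T)
  initial_bound : ∀ T : ℝ, 0 < T → ‖ψ T 0‖ < δ
  terminal_bound : ∀ T : ℝ, 0 < T → ‖ψ T T‖ < δ

/-- `‖e‖²_{H¹(0,T)} = ∫₀ᵀ ‖e‖² dt + ∫₀ᵀ ‖de/dt‖² dt`, as an extended nonnegative number. -/
noncomputable def h1NormSq {X : Type*} [NormedAddCommGroup X] [InnerProductSpace ℝ X]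
    (T : ℝ) (e : ℝ → X) : ℝ≥0∞ :=
  (∫⁻ t in Icc 0 T, ‖e t‖ₑ ^ 2) + ∫⁻ t in Icc 0 T, ‖derivWithin e (Icc 0 T) t‖ₑ ^ 2

/-- `‖e‖_{H¹(0,T)}`. -/
noncomputable def h1Norm {X : Type*} [NormedAddCommGroup X] [InnerProductSpace ℝ X]
    (T : ℝ) (e : ℝ → X) : ℝ≥0∞ :=
  h1NormSq T e ^ (1 / 2 : ℝ)

/-! The forcing `J_u` cancels in `e = ψ_T - ψ^∞`, so `e` solves the homogeneous adjoint equation and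
its pairing with any tangent solution is constant in time. The quantity `⟪ψ, f⟫ + J` is conserved
along adjoint solutions; the average condition fixes its value for `ψ^∞` at `Jbar`, and the terminal
condition gives `ψ_T` the same value, so `⟪e, f⟫ = 0`.

Split `e t = a + k • f + c` along the hyperbolic splitting. Then `‖e t‖² = ⟪e t, a⟫ + ⟪e t, c⟫`.
Pulling the unstable `a` back to time `0` and pushing the stable `c` forward to time `T` contracts
both vectors, and at those times `e` is bounded. Since `‖a‖ + ‖c‖` is at most a uniform multiple of
`‖e t‖` (`exists_projection_bound`), `‖e t‖` decays exponentially away from both ends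
(`exists_adjoint_decay`). The squared decay profile has integral bounded in `T`, and `e' = -f_u^* e`
inherits the estimate. -/

/-! ### Linear differential equations on a compact interval. -/

section LinearODE

/-- Grönwall bound for a curve whose derivative is bounded by a multiple of its norm. -/
lemma norm_le_mul_exp_of_hasDerivWithinAt {X : Type*} [NormedAddCommGroup X] [NormedSpace ℝ X]
    {v v' : ℝ → X} {τ L : ℝ}
    (hv : ∀ t ∈ Icc 0 τ, HasDerivWithinAt v (v' t) (Icc 0 τ) t)
    (hb : ∀ t ∈ Icc 0 τ, ‖v' t‖ ≤ L * ‖v t‖) :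
    ∀ t ∈ Icc 0 τ, ‖v t‖ ≤ ‖v 0‖ * Real.exp (L * t) := by
  intro t ht
  have := norm_le_gronwallBound_of_norm_deriv_right_le (f := v) (f' := v') (δ := ‖v 0‖)
    (K := L) (ε := 0) (a := 0) (b := τ) (fun x hx => (hv x hx).continuousWithinAt)
    (fun x hx => ((hv x ⟨hx.1, hx.2.le⟩).mono_of_mem_nhdsWithin
      (Icc_mem_nhdsGE_of_mem hx))) le_rfl
    (fun x hx => by simpa using hb x ⟨hx.1, hx.2.le⟩) t ht
  simpa [gronwallBound_ε0] using this

/-- The radial retraction onto a ball is Lipschitz. -/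
lemma lipschitzWith_radial_retraction {X : Type*} [NormedAddCommGroup X] [NormedSpace ℝ X]
    {R : ℝ} (hR : 0 < R) :
    LipschitzWith 2 (fun x : X => (R / max R ‖x‖) • x) := by
  refine LipschitzWith.of_dist_le_mul fun x y => ?_
  rw [dist_eq_norm, dist_eq_norm]
  have hx : 0 < max R ‖x‖ := lt_max_of_lt_left hR
  have hy : 0 < max R ‖y‖ := lt_max_of_lt_left hR
  have e : (R / max R ‖x‖) • x - (R / max R ‖y‖) • y
      = (R / max R ‖y‖) • (x - y) + (R / max R ‖x‖ - R / max R ‖y‖) • x := by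
    simp only [smul_sub, sub_smul]; abel
  have h1 : ‖(R / max R ‖y‖) • (x - y)‖ ≤ ‖x - y‖ := by
    rw [norm_smul, Real.norm_of_nonneg (by positivity)]
    exact mul_le_of_le_one_left (norm_nonneg _) ((div_le_one hy).2 (le_max_left _ _))
  have h2 : ‖(R / max R ‖x‖ - R / max R ‖y‖) • x‖ ≤ ‖x - y‖ := by
    have hm : |max R ‖y‖ - max R ‖x‖| ≤ ‖x - y‖ := by
      refine (abs_max_sub_max_le_max _ _ _ _).trans ?_
      simp only [sub_self, abs_zero]
      refine max_le (norm_nonneg _) ?_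
      rw [norm_sub_rev]
      exact abs_norm_sub_norm_le y x
    have : R / max R ‖x‖ - R / max R ‖y‖
        = (R / max R ‖y‖) * ((max R ‖y‖ - max R ‖x‖) / max R ‖x‖) := by
      field_simp
    rw [this, norm_smul, Real.norm_eq_abs, abs_mul, abs_div, abs_div, abs_of_pos hR,
      abs_of_pos hx, abs_of_pos hy]
    have a1 : R / max R ‖y‖ ≤ 1 := (div_le_one hy).2 (le_max_left _ _)
    have a2 : ‖x‖ / max R ‖x‖ ≤ 1 := (div_le_one hx).2 (le_max_right _ _)
    calc R / max R ‖y‖ * (|max R ‖y‖ - max R ‖x‖| / max R ‖x‖) * ‖x‖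
        = R / max R ‖y‖ * (|max R ‖y‖ - max R ‖x‖| * (‖x‖ / max R ‖x‖)) := by ring
      _ ≤ 1 * (‖x - y‖ * 1) := by gcongr
      _ = ‖x - y‖ := by ring
  rw [e]
  refine (norm_add_le _ _).trans ?_
  push_cast
  linarith

/-- A linear equation with continuous bounded coefficients is solvable on `[0, τ]`. -/
lemma exists_linear_ode_solution {X : Type*} [NormedAddCommGroup X] [NormedSpace ℝ X]
    [CompleteSpace X] {A : ℝ → X →L[ℝ] X} {τ L : ℝ} (hτ : 0 ≤ τ) (hL : 0 ≤ L)
    (hA : ContinuousOn A (Icc 0 τ)) (hAL : ∀ t ∈ Icc 0 τ, ‖A t‖ ≤ L) (w : X) :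
    ∃ v : ℝ → X, v 0 = w ∧ ∀ t ∈ Icc 0 τ, HasDerivWithinAt v (A t (v t)) (Icc 0 τ) t := by
  -- The Grönwall bound on `[0, τ]` plus one, so that solutions stay where the truncation `P` is the
  -- identity.
  set R : ℝ := ‖w‖ * Real.exp (L * τ) + 1 with hRdef
  have hR : 0 < R := by positivity
  set P : X → X := fun x => (R / max R ‖x‖) • x with hP
  have hPn : ∀ x, ‖P x‖ ≤ ‖x‖ := fun x => by
    have hx : 0 < max R ‖x‖ := lt_max_of_lt_left hR
    rw [hP]
    simp only
    rw [norm_smul, Real.norm_of_nonneg (by positivity)]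
    exact mul_le_of_le_one_left (norm_nonneg _) ((div_le_one hx).2 (le_max_left _ _))
  have hPR : ∀ x, ‖P x‖ ≤ R := fun x => by
    have hx : 0 < max R ‖x‖ := lt_max_of_lt_left hR
    rw [hP]
    simp only
    rw [norm_smul, Real.norm_of_nonneg (by positivity), div_mul_eq_mul_div, div_le_iff₀ hx]
    exact mul_le_mul_of_nonneg_left (le_max_right _ _) hR.le
  have hPid : ∀ x, ‖x‖ ≤ R → P x = x := fun x hx => by
    rw [hP]; simp [max_eq_left hx, hR.ne']
  -- The truncated field is bounded by `L * R` everywhere, so a ball of radius `L * R * τ` permits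
  -- one Picard–Lindelöf step over all of `[0, τ]`.
  have hpl : IsPicardLindelof (fun t x => A t (P x)) (⟨0, left_mem_Icc.2 hτ⟩ : Icc (0 : ℝ) τ) w
      (Real.toNNReal (L * R * τ)) 0 (Real.toNNReal (L * R)) (Real.toNNReal L * 2) := by
    refine ⟨fun t ht => ?_, fun x _ => hA.clm_apply continuousOn_const, fun t ht x _ => ?_, ?_⟩
    · refine LipschitzWith.lipschitzOnWith ?_
      refine LipschitzWith.comp ?_ (lipschitzWith_radial_retraction hR)
      refine (A t).lipschitz.weaken ?_
      rw [← NNReal.coe_le_coe, Real.coe_toNNReal _ hL]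
      exact hAL t ht
    · rw [Real.coe_toNNReal _ (by positivity)]
      exact ((A t).le_opNorm _).trans (mul_le_mul (hAL t ht) (hPR x) (norm_nonneg _) hL)
    · rw [Real.coe_toNNReal _ (by positivity), Real.coe_toNNReal _ (by positivity)]
      simp [hτ]
  obtain ⟨v, hv0, hv⟩ := hpl.exists_eq_forall_mem_Icc_hasDerivWithinAt₀
  refine ⟨v, hv0, fun t ht => ?_⟩
  -- Since `‖P x‖ ≤ ‖x‖`, the truncated equation obeys the same Grönwall bound, and the truncation
  -- is never active.
  have hg := norm_le_mul_exp_of_hasDerivWithinAt (L := L) hv (fun t ht =>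
    ((A t).le_opNorm _).trans (mul_le_mul (hAL t ht) (hPn _) (norm_nonneg _) hL)) t ht
  have : P (v t) = v t := by
    refine hPid _ (hg.trans ?_)
    have hv0' : v 0 = w := hv0
    rw [hv0', hRdef]
    have : Real.exp (L * t) ≤ Real.exp (L * τ) :=
      Real.exp_le_exp.2 (mul_le_mul_of_nonneg_left ht.2 hL)
    nlinarith [norm_nonneg w]
  simpa [this] using hv t ht

lemma hasDerivWithinAt_comp_const_sub_Icc {X : Type*} [NormedAddCommGroup X] [NormedSpace ℝ X]
    {z : ℝ → X} {z' : X} {τ t : ℝ}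
    (h : HasDerivWithinAt z z' (Icc 0 τ) (τ - t)) :
    HasDerivWithinAt (fun s => z (τ - s)) (-z') (Icc 0 τ) t := by
  have h1 : HasDerivWithinAt (fun s : ℝ => τ - s) (-1) (Icc 0 τ) t :=
    ((hasDerivAt_id t).const_sub τ).hasDerivWithinAt
  have := h.scomp t h1 (fun s hs => ⟨by linarith [hs.2], by linarith [hs.1]⟩)
  simpa using! this

lemma exists_linear_ode_solution_terminal {X : Type*} [NormedAddCommGroup X] [NormedSpace ℝ X]
    [CompleteSpace X] {A : ℝ → X →L[ℝ] X} {τ L : ℝ} (hτ : 0 ≤ τ) (hL : 0 ≤ L)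
    (hA : ContinuousOn A (Icc 0 τ)) (hAL : ∀ t ∈ Icc 0 τ, ‖A t‖ ≤ L) (w : X) :
    ∃ v : ℝ → X, v τ = w ∧ ∀ t ∈ Icc 0 τ, HasDerivWithinAt v (A t (v t)) (Icc 0 τ) t := by
  have hm : MapsTo (fun t : ℝ => τ - t) (Icc 0 τ) (Icc 0 τ) :=
    fun s hs => ⟨by linarith [hs.2], by linarith [hs.1]⟩
  obtain ⟨z, hz0, hz⟩ := exists_linear_ode_solution (A := fun t => -A (τ - t)) hτ hL
    (hA.comp (by fun_prop) hm).neg (fun t ht => by simpa using hAL _ (hm ht)) w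
  refine ⟨fun t => z (τ - t), by simpa using hz0, fun t ht => ?_⟩
  have := hasDerivWithinAt_comp_const_sub_Icc (hz _ (hm ht))
  simpa using this

/-- Backward Grönwall bound. -/
lemma norm_zero_le_mul_exp_of_hasDerivWithinAt {X : Type*} [NormedAddCommGroup X]
    [NormedSpace ℝ X] {v v' : ℝ → X} {τ L : ℝ} (hτ : 0 ≤ τ)
    (hv : ∀ t ∈ Icc 0 τ, HasDerivWithinAt v (v' t) (Icc 0 τ) t)
    (hb : ∀ t ∈ Icc 0 τ, ‖v' t‖ ≤ L * ‖v t‖) :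
    ‖v 0‖ ≤ ‖v τ‖ * Real.exp (L * τ) := by
  have hm : MapsTo (fun t : ℝ => τ - t) (Icc 0 τ) (Icc 0 τ) :=
    fun s hs => ⟨by linarith [hs.2], by linarith [hs.1]⟩
  simpa using norm_le_mul_exp_of_hasDerivWithinAt (v := fun t => v (τ - t))
    (v' := fun t => -v' (τ - t)) (τ := τ) (L := L)
    (fun t ht => hasDerivWithinAt_comp_const_sub_Icc (hv _ (hm ht)))
    (fun t ht => by simpa using hb _ (hm ht)) τ (right_mem_Icc.2 hτ)

end LinearODE

/-! ### Tangent dynamics and uniform bounds on the hyperbolic splitting. -/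

section Hyperbolic

variable {X : Type*} [NormedAddCommGroup X] [InnerProductSpace ℝ X]
  {f : X → X} {Λ : Set X} {Eu Es : X → Submodule ℝ X} {u : ℝ → X}

lemma IsTrajectory.shift (hu : IsTrajectory f Λ u) {s : ℝ} (hs : 0 ≤ s) :
    IsTrajectory f Λ (fun t => u (s + t)) := by
  intro t ht
  have hst : s + t ∈ Ici (0 : ℝ) := add_nonneg hs ht
  refine ⟨(hu _ hst).1, ?_⟩
  have h1 : HasDerivWithinAt (fun t : ℝ => s + t) 1 (Ici 0) t :=
    ((hasDerivAt_id t).const_add s).hasDerivWithinAt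
  simpa using! (hu _ hst).2.scomp t h1 (fun r hr => add_nonneg hs hr)

lemma isTrajectory_comp_sub {y : ℝ → X} (hy : ∀ t : ℝ, y t ∈ Λ ∧ HasDerivAt y (f (y t)) t)
    (s : ℝ) : IsTrajectory f Λ (fun t => y (t - s)) := by
  intro t _
  exact ⟨(hy _).1, ((hy (t - s)).2.comp_sub_const t s).hasDerivWithinAt⟩

lemma IsTrajectory.continuousOn (hu : IsTrajectory f Λ u) : ContinuousOn u (Ici 0) :=
  fun t ht => (hu t ht).2.continuousWithinAt

lemma IsTrajectory.continuousOn_comp {Y : Type*} [TopologicalSpace Y] {g : X → Y}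
    (hu : IsTrajectory f Λ u) (hg : ContinuousOn g Λ) :
    ContinuousOn (fun t => g (u t)) (Ici 0) :=
  hg.comp hu.continuousOn fun t ht => (hu t ht).1

/-- The velocity of a trajectory solves the tangent equation. -/
lemma IsTrajectory.hasDerivWithinAt_velocity (hf : ∀ x ∈ Λ, DifferentiableAt ℝ f x)
    (hu : IsTrajectory f Λ u) {t : ℝ} (ht : 0 ≤ t) :
    HasDerivWithinAt (fun s => f (u s)) (fderiv ℝ f (u t) (f (u t))) (Ici 0) t :=
  (hf _ (hu t ht).1).hasFDerivAt.comp_hasDerivWithinAt t (hu t ht).2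

lemma IsTrajectory.isTangentSolution_velocity (hf : ∀ x ∈ Λ, DifferentiableAt ℝ f x)
    (hu : IsTrajectory f Λ u) (k τ : ℝ) : IsTangentSolution f u (fun t => k • f (u t)) τ := by
  intro t ht
  have := (HasDerivWithinAt.mono (s := Icc 0 τ) (hu.hasDerivWithinAt_velocity hf ht.1)
    fun r hr => hr.1).const_smul k
  simpa using! this

lemma IsTangentSolution.add {v w : ℝ → X} {τ : ℝ} (hv : IsTangentSolution f u v τ)
    (hw : IsTangentSolution f u w τ) : IsTangentSolution f u (fun t => v t + w t) τ := by
  intro t ht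
  simpa using! (hv t ht).add (hw t ht)

variable [CompleteSpace X] {L : ℝ}

lemma IsTrajectory.exists_tangent (hf' : ContinuousOn (fderiv ℝ f) Λ)
    (hL : ∀ x ∈ Λ, ‖fderiv ℝ f x‖ ≤ L) (hu : IsTrajectory f Λ u) {τ : ℝ} (hτ : 0 ≤ τ) (w : X) :
    ∃ v : ℝ → X, v 0 = w ∧ IsTangentSolution f u v τ :=
  exists_linear_ode_solution hτ ((norm_nonneg _).trans (hL _ (hu 0 self_mem_Ici).1))
    ((hu.continuousOn_comp hf').mono Icc_subset_Ici_self) (fun t ht => hL _ (hu t ht.1).1) w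

lemma IsTrajectory.exists_tangent_terminal (hf' : ContinuousOn (fderiv ℝ f) Λ)
    (hL : ∀ x ∈ Λ, ‖fderiv ℝ f x‖ ≤ L) (hu : IsTrajectory f Λ u) {τ : ℝ} (hτ : 0 ≤ τ) (w : X) :
    ∃ v : ℝ → X, v τ = w ∧ IsTangentSolution f u v τ :=
  exists_linear_ode_solution_terminal hτ ((norm_nonneg _).trans (hL _ (hu 0 self_mem_Ici).1))
    ((hu.continuousOn_comp hf').mono Icc_subset_Ici_self) (fun t ht => hL _ (hu t ht.1).1) w

omit [CompleteSpace X] in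
lemma IsTangentSolution.norm_le (hL : ∀ x ∈ Λ, ‖fderiv ℝ f x‖ ≤ L) (hu : IsTrajectory f Λ u)
    {v : ℝ → X} {τ : ℝ} (hτ : 0 ≤ τ) (hv : IsTangentSolution f u v τ) :
    ‖v τ‖ ≤ ‖v 0‖ * Real.exp (L * τ) ∧ ‖v 0‖ ≤ ‖v τ‖ * Real.exp (L * τ) := by
  have hb : ∀ t ∈ Icc 0 τ, ‖fderiv ℝ f (u t) (v t)‖ ≤ L * ‖v t‖ := fun t ht =>
    ((fderiv ℝ f (u t)).le_opNorm _).trans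
      (mul_le_mul_of_nonneg_right (hL _ (hu t ht.1).1) (norm_nonneg _))
  exact ⟨norm_le_mul_exp_of_hasDerivWithinAt hv hb τ (right_mem_Icc.2 hτ),
    norm_zero_le_mul_exp_of_hasDerivWithinAt hτ hv hb⟩

omit [CompleteSpace X] in
lemma IsUniformlyHyperbolic.exists_decomposition (hΛ : IsUniformlyHyperbolic f Λ Eu Es)
    {x : X} (hx : x ∈ Λ) (w : X) :
    ∃ a ∈ Eu x, ∃ k : ℝ, ∃ c ∈ Es x, w = a + k • f x + c := by
  have h := (hΛ.splitting x hx).submodule_iSup_eq_top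
  have hw : w ∈ Eu x ⊔ Submodule.span ℝ {f x} ⊔ Es x := by
    have : (⨆ i, ![Eu x, Submodule.span ℝ {f x}, Es x] i)
        ≤ Eu x ⊔ Submodule.span ℝ {f x} ⊔ Es x := by
      refine iSup_le fun i => ?_
      fin_cases i
      · exact le_sup_left.trans le_sup_left
      · exact le_sup_right.trans le_sup_left
      · exact le_sup_right
    rw [h] at this
    exact this trivial
  obtain ⟨y, hy, c, hc, rfl⟩ := Submodule.mem_sup.1 hw
  obtain ⟨a, ha, b, hb, rfl⟩ := Submodule.mem_sup.1 hy
  obtain ⟨k, rfl⟩ := Submodule.mem_span_singleton.1 hb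
  exact ⟨a, ha, k, c, hc, rfl⟩

/-- The stable and unstable projections are uniformly bounded over a hyperbolic set. -/
lemma IsUniformlyHyperbolic.exists_projection_bound (hf : ∀ x ∈ Λ, DifferentiableAt ℝ f x)
    (hf' : ContinuousOn (fderiv ℝ f) Λ) (hΛ : IsUniformlyHyperbolic f Λ Eu Es)
    (hL : ∀ x ∈ Λ, ‖fderiv ℝ f x‖ ≤ L) :
    ∃ B : ℝ, 0 ≤ B ∧ ∀ x ∈ Λ, ∀ a ∈ Eu x, ∀ k : ℝ, ∀ c ∈ Es x,
      ‖a‖ + ‖c‖ ≤ B * ‖a + k • f x + c‖ := by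
  rcases Λ.eq_empty_or_nonempty with rfl | hne
  · exact ⟨0, le_rfl, fun x hx => hx.elim⟩
  have hfc : ContinuousOn (fun x => ‖f x‖) Λ :=
    fun x hx => (hf x hx).continuousAt.norm.continuousWithinAt
  obtain ⟨x0, hx0, hmin⟩ := hΛ.isCompact.exists_isMinOn hne hfc
  obtain ⟨x1, hx1, hmax⟩ := hΛ.isCompact.exists_isMaxOn hne hfc
  obtain ⟨C, μ, hC, hμ, hrate⟩ := hΛ.rates
  set m := ‖f x0‖ with hm
  have hmpos : 0 < m := norm_pos_iff.2 (hΛ.ne_zero _ hx0)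
  set K := ‖f x1‖ / m with hK
  have hKn : 0 ≤ K := by positivity
  -- Compactness and `f ≠ 0` make speeds on `Λ` comparable: the flow stretches neutral vectors by at
  -- most `K`.
  have hfK : ∀ x ∈ Λ, ∀ y ∈ Λ, ‖f y‖ ≤ K * ‖f x‖ := fun x hx y hy => by
    have h1 : ‖f y‖ ≤ ‖f x1‖ := hmax hy
    have h2 : m ≤ ‖f x‖ := hmin hx
    calc ‖f y‖ ≤ ‖f x1‖ := h1
      _ = K * m := by rw [hK]; field_simp
      _ ≤ K * ‖f x‖ := by gcongr
  have hlim : Tendsto (fun s : ℝ => C * Real.exp (-μ * s)) atTop (𝓝 0) := by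
    have : Tendsto (fun s : ℝ => -μ * s) atTop atBot :=
      tendsto_id.const_mul_atTop_of_neg (by linarith)
    simpa using (Real.tendsto_exp_atBot.comp this).const_mul C
  -- The time `s` is long enough that `q * (2 * K + 1) < 1 / 2`, which lets `e6` absorb half of `‖a‖
  -- + ‖c‖` on the left.
  obtain ⟨s, hs0, hs⟩ := ((eventually_ge_atTop (0 : ℝ)).and (hlim.eventually
    (gt_mem_nhds (show (0 : ℝ) < 1 / (2 * (2 * K + 1)) by positivity)))).exists
  set q := C * Real.exp (-μ * s) with hq
  have hqn : 0 ≤ q := by positivity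
  rw [lt_div_iff₀ (by positivity)] at hs
  have hq1 : q ≤ 1 := by nlinarith
  set G := Real.exp (L * s) with hG
  have hGn : 0 ≤ G := by positivity
  refine ⟨4 * G + 4 * K, by positivity, fun x hx a ha k c hc => ?_⟩
  set w := a + k • f x + c with hw
  obtain ⟨y, hy0, hy⟩ := hΛ.invariant x hx
  -- Flow forward for time `s`: `‖a‖` is at most `q` times its image, which is the image of `w`
  -- minus the neutral and stable images.
  have e1 : ‖a‖ ≤ q * (G * ‖w‖ + K * ‖k • f x‖ + q * ‖c‖) := by
    have hyt : IsTrajectory f Λ y := by simpa using isTrajectory_comp_sub hy 0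
    obtain ⟨va, hva0, hva⟩ := hyt.exists_tangent hf' hL hs0 a
    obtain ⟨vc, hvc0, hvc⟩ := hyt.exists_tangent hf' hL hs0 c
    have hvb := hyt.isTangentSolution_velocity hf k s
    have hsum := (((hva.add hvb).add hvc).norm_le hL hyt hs0).1
    simp only [hva0, hvc0, hy0] at hsum
    have r1 := (hrate y hyt s hs0 va hva).2 (by rw [hva0, hy0]; exact ha)
    have r2 := (hrate y hyt s hs0 vc hvc).1 (by rw [hvc0, hy0]; exact hc)
    rw [hva0] at r1
    rw [hvc0] at r2
    refine r1.trans (mul_le_mul_of_nonneg_left ?_ hqn)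
    have hb : ‖k • f (y s)‖ ≤ K * ‖k • f x‖ := by
      rw [norm_smul, norm_smul]
      nlinarith [hfK x hx (y s) (hy s).1, norm_nonneg k]
    have : va s = (va s + k • f (y s) + vc s) - k • f (y s) - vc s := by abel
    rw [this]
    refine (norm_sub_le _ _).trans (add_le_add ((norm_sub_le _ _).trans
      (add_le_add ?_ hb)) r2)
    rw [mul_comm]; exact hsum
  -- The mirror estimate backward in time: the shifted trajectory starts at `y (-s)` and reaches `x`
  -- at time `s`. Invariance of the subspaces places the pulled-back vectors.
  have e2 : ‖c‖ ≤ q * (G * ‖w‖ + K * ‖k • f x‖ + q * ‖a‖) := by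
    have hyt := isTrajectory_comp_sub hy s
    obtain ⟨va, hva0, hva⟩ := hyt.exists_tangent_terminal hf' hL hs0 a
    obtain ⟨vc, hvc0, hvc⟩ := hyt.exists_tangent_terminal hf' hL hs0 c
    have hvb := hyt.isTangentSolution_velocity hf k s
    have hsum := (((hva.add hvb).add hvc).norm_le hL hyt hs0).2
    simp only [hva0, hvc0, sub_self, hy0] at hsum
    have r1 := (hrate _ hyt s hs0 va hva).2
      ((hΛ.unstable_invariant _ hyt s hs0 va hva).2 (by simpa [hva0, hy0] using ha))
    have r2 := (hrate _ hyt s hs0 vc hvc).1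
      ((hΛ.stable_invariant _ hyt s hs0 vc hvc).2 (by simpa [hvc0, hy0] using hc))
    rw [hva0] at r1
    rw [hvc0] at r2
    refine r2.trans (mul_le_mul_of_nonneg_left ?_ hqn)
    have hb : ‖k • f (y (0 - s))‖ ≤ K * ‖k • f x‖ := by
      rw [norm_smul, norm_smul]
      nlinarith [hfK x hx (y (0 - s)) (hy _).1, norm_nonneg k]
    have : vc 0 = (va 0 + k • f (y (0 - s)) + vc 0) - k • f (y (0 - s)) - va 0 := by abel
    rw [this]
    refine (norm_sub_le _ _).trans (add_le_add ((norm_sub_le _ _).trans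
      (add_le_add ?_ hb)) r1)
    rw [mul_comm]; exact hsum
  have e3 : ‖k • f x‖ ≤ ‖w‖ + ‖a‖ + ‖c‖ := by
    have : k • f x = w - a - c := by rw [hw]; abel
    rw [this]
    exact (norm_sub_le _ _).trans (add_le_add_left (norm_sub_le _ _) _)
  have e4 : ‖a‖ + ‖c‖ ≤ q * (2 * (G + K) * ‖w‖ + (2 * K + 1) * (‖a‖ + ‖c‖)) := by
    have h1 : K * ‖k • f x‖ ≤ K * (‖w‖ + ‖a‖ + ‖c‖) := mul_le_mul_of_nonneg_left e3 hKn
    have h2 : q * ‖a‖ ≤ ‖a‖ := mul_le_of_le_one_left (norm_nonneg _) hq1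
    have h3 : q * ‖c‖ ≤ ‖c‖ := mul_le_of_le_one_left (norm_nonneg _) hq1
    calc ‖a‖ + ‖c‖ ≤ q * ((G * ‖w‖ + K * ‖k • f x‖ + q * ‖c‖)
          + (G * ‖w‖ + K * ‖k • f x‖ + q * ‖a‖)) := by rw [mul_add]; exact add_le_add e1 e2
      _ ≤ _ := mul_le_mul_of_nonneg_left (by linarith) hqn
  have e5 : q * (2 * (G + K) * ‖w‖) ≤ 2 * (G + K) * ‖w‖ :=
    mul_le_of_le_one_left (by positivity) hq1
  have e6 : q * (2 * K + 1) * (‖a‖ + ‖c‖) ≤ 1 / 2 * (‖a‖ + ‖c‖) :=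
    mul_le_mul_of_nonneg_right (by linarith) (by positivity)
  linarith

end Hyperbolic

/-! ### Conserved pairings and decay of homogeneous adjoint solutions. -/

section AdjointError

lemma eq_of_hasDerivWithinAt_zero_Icc {g : ℝ → ℝ} {a b : ℝ}
    (hg : ∀ t ∈ Icc a b, HasDerivWithinAt g 0 (Icc a b) t) : ∀ t ∈ Icc a b, g t = g a :=
  constant_of_has_deriv_right_zero (fun t ht => (hg t ht).continuousWithinAt)
    fun t ht => (hg t ⟨ht.1, ht.2.le⟩).mono_of_mem_nhdsWithin (Icc_mem_nhdsGE_of_mem ht)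

/-- A curve decaying exponentially away from both ends of `[0, T]` has an `L²` norm that is
bounded independently of `T`. -/
lemma setLIntegral_enorm_sq_le_of_exp_decay {E : Type*} [NormedAddCommGroup E]
    {g : ℝ → E} {T N μ : ℝ} (hT : 0 ≤ T) (hμ : 0 < μ)
    (hg : ∀ t ∈ Icc 0 T, ‖g t‖ ≤ N * (Real.exp (-μ * t) + Real.exp (-μ * (T - t)))) :
    ∫⁻ t in Icc 0 T, ‖g t‖ₑ ^ 2 ≤ ENNReal.ofReal (2 * N ^ 2 / μ) := by
  -- The factor `2` comes from `(x + y)² ≤ 2 * (x² + y²)`.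
  set h : ℝ → ℝ := fun t => 2 * N ^ 2 * (Real.exp (-(2 * μ) * t) + Real.exp (-(2 * μ) * (T - t)))
    with hh
  have hc : Continuous h := by fun_prop
  have h0 : ∀ t, 0 ≤ h t := fun t => by positivity
  have hle : ∀ t ∈ Icc 0 T, ‖g t‖ₑ ^ 2 ≤ ENNReal.ofReal (h t) := fun t ht => by
    rw [← ofReal_norm, ← ENNReal.ofReal_pow (norm_nonneg _)]
    refine ENNReal.ofReal_le_ofReal ((pow_le_pow_left₀ (norm_nonneg _) (hg t ht) 2).trans ?_)
    have e1 : ∀ r : ℝ, Real.exp (-(2 * μ) * r) = Real.exp (-μ * r) ^ 2 := fun r => by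
      rw [← Real.exp_nat_mul]; congr 1; push_cast; ring
    rw [hh]
    simp only
    rw [e1, e1, mul_pow, mul_comm 2 (N ^ 2), mul_assoc]
    exact mul_le_mul_of_nonneg_left add_sq_le (sq_nonneg N)
  have hint : ∫ t in (0 : ℝ)..T, h t ≤ 2 * N ^ 2 / μ := by
    have hd : ∀ t : ℝ, HasDerivAt (fun t => 2 * N ^ 2 / (2 * μ) *
        (-Real.exp (-(2 * μ) * t) + Real.exp (-(2 * μ) * (T - t)))) (h t) t := fun t => by
      have d1 : HasDerivAt (fun t : ℝ => -(2 * μ) * t) (-(2 * μ)) t := by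
        simpa using (hasDerivAt_id t).const_mul (-(2 * μ))
      have d2 : HasDerivAt (fun t : ℝ => -(2 * μ) * (T - t)) (2 * μ) t := by
        simpa using ((hasDerivAt_id t).const_sub T).const_mul (-(2 * μ))
      convert! (d1.exp.neg.add d2.exp).const_mul (2 * N ^ 2 / (2 * μ)) using 1
      rw [hh]
      field_simp
    rw [intervalIntegral.integral_eq_sub_of_hasDerivAt (fun t _ => hd t)
      (hc.intervalIntegrable 0 T)]
    have hp : 0 ≤ 2 * N ^ 2 / (2 * μ) := by positivity
    have hx : 0 ≤ Real.exp (-(2 * μ) * T) := (Real.exp_pos _).le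
    have : 2 * N ^ 2 / μ = 2 * N ^ 2 / (2 * μ) * 2 := by field_simp
    rw [this]
    simp only [sub_self, mul_zero, Real.exp_zero, sub_zero]
    nlinarith
  calc ∫⁻ t in Icc 0 T, ‖g t‖ₑ ^ 2
      ≤ ∫⁻ t in Icc 0 T, ENNReal.ofReal (h t) := setLIntegral_mono' measurableSet_Icc hle
    _ = ENNReal.ofReal (∫ t in Icc 0 T, h t) :=
        (ofReal_integral_eq_lintegral_ofReal (hc.continuousOn.integrableOn_Icc)
          (Eventually.of_forall h0)).symm
    _ ≤ _ := by
        rw [integral_Icc_eq_integral_Ioc, ← intervalIntegral.integral_of_le hT]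
        exact ENNReal.ofReal_le_ofReal hint

variable {X : Type*} [NormedAddCommGroup X] [InnerProductSpace ℝ X] [CompleteSpace X]
  {f : X → X} {J : X → ℝ} {Λ : Set X} {Eu Es : X → Submodule ℝ X} {u : ℝ → X}

/-- The pairing of a homogeneous adjoint solution with a tangent solution is constant. -/
lemma IsTangentSolution.inner_eq {e v : ℝ → X} {τ : ℝ} (hτ : 0 ≤ τ)
    (he : ∀ t ∈ Icc 0 τ, HasDerivWithinAt e
      (-ContinuousLinearMap.adjoint (fderiv ℝ f (u t)) (e t)) (Icc 0 τ) t)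
    (hv : IsTangentSolution f u v τ) : ⟪e τ, v τ⟫_ℝ = ⟪e 0, v 0⟫_ℝ := by
  refine eq_of_hasDerivWithinAt_zero_Icc (g := fun t => ⟪e t, v t⟫_ℝ) (fun t ht => ?_) τ
    (right_mem_Icc.2 hτ)
  have := (he t ht).inner ℝ (hv t ht)
  simpa [ContinuousLinearMap.adjoint_inner_left] using! this

lemma IsAdjointSolution.hasDerivWithinAt {ψ : ℝ → X} {I : Set ℝ}
    (h : IsAdjointSolution f J u ψ I) {t : ℝ} (ht : t ∈ I) :
    HasDerivWithinAt ψ (-ContinuousLinearMap.adjoint (fderiv ℝ f (u t)) (ψ t) - ∇ J (u t)) I t := by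
  obtain ⟨ψ', h1, h2⟩ := h t ht
  have : ψ' = -ContinuousLinearMap.adjoint (fderiv ℝ f (u t)) (ψ t) - ∇ J (u t) := by
    rw [← sub_eq_zero, ← h2]; abel
  rwa [← this]

/-- Along an adjoint solution `⟪ψ, f⟫ + J` is conserved. -/
lemma IsAdjointSolution.inner_add_eq (hf : ∀ x ∈ Λ, DifferentiableAt ℝ f x)
    (hJ : ∀ x ∈ Λ, DifferentiableAt ℝ J x) (hu : IsTrajectory f Λ u) {ψ : ℝ → X}
    (h : IsAdjointSolution f J u ψ (Ici 0)) {t : ℝ} (ht : 0 ≤ t) :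
    ⟪ψ t, f (u t)⟫_ℝ + J (u t) = ⟪ψ 0, f (u 0)⟫_ℝ + J (u 0) := by
  refine eq_of_hasDerivWithinAt_zero_Icc (g := fun t => ⟪ψ t, f (u t)⟫_ℝ + J (u t))
    (b := t) (fun s hs => ?_) t (right_mem_Icc.2 ht)
  refine HasDerivWithinAt.mono (t := Ici 0) ?_ Icc_subset_Ici_self
  have h1 := (h.hasDerivWithinAt (t := s) hs.1).inner ℝ (hu.hasDerivWithinAt_velocity hf hs.1)
  have h2 : HasDerivWithinAt (fun s => J (u s)) ⟪∇ J (u s), f (u s)⟫_ℝ (Ici 0) s := by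
    have := (hJ _ (hu s hs.1).1).hasGradientAt.hasFDerivAt.comp_hasDerivWithinAt s (hu s hs.1).2
    simpa using! this
  convert! h1.add h2 using 1
  rw [inner_sub_left, inner_neg_left, ContinuousLinearMap.adjoint_inner_left]
  ring

/-- The conserved quantity of the adjoint shadowing direction is the long-time average of `J`. -/
lemma IsAdjointShadowingDirection.inner_add_eq (hf : ∀ x ∈ Λ, DifferentiableAt ℝ f x)
    (hJ : ∀ x ∈ Λ, DifferentiableAt ℝ J x) (hu : IsTrajectory f Λ u) {Jbar : ℝ}
    (hJbar : Tendsto (fun T : ℝ => (1 / T) * ∫ t in (0 : ℝ)..T, J (u t)) atTop (𝓝 Jbar))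
    {ψ : ℝ → X} (h : IsAdjointShadowingDirection f J Eu Es u ψ) {t : ℝ} (ht : 0 ≤ t) :
    ⟪ψ t, f (u t)⟫_ℝ + J (u t) = Jbar := by
  rw [h.adjoint.inner_add_eq hf hJ hu ht]
  set c := ⟪ψ 0, f (u 0)⟫_ℝ + J (u 0) with hc
  have hlim := h.average_zero.add hJbar
  rw [zero_add] at hlim
  -- The average of the constant `c` over `[0, T]` is `c`, while its limit is `0 + Jbar`.
  refine tendsto_nhds_unique (tendsto_const_nhds.congr' ?_) hlim
  filter_upwards [eventually_gt_atTop (0 : ℝ)] with T hT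
  have hsub : uIcc 0 T ⊆ Ici 0 := by rw [uIcc_of_le hT.le]; exact Icc_subset_Ici_self
  have hfu : ContinuousOn (fun t => f (u t)) (Ici 0) :=
    hu.continuousOn_comp fun x hx => (hf x hx).continuousAt.continuousWithinAt
  have hψc : ContinuousOn ψ (Ici 0) := fun s hs => (h.adjoint.hasDerivWithinAt hs).continuousWithinAt
  have hJu : ContinuousOn (fun t => J (u t)) (Ici 0) :=
    hu.continuousOn_comp fun x hx => (hJ x hx).continuousAt.continuousWithinAt
  rw [← mul_add, ← intervalIntegral.integral_add
    ((hψc.inner hfu).mono hsub).intervalIntegrable (hJu.mono hsub).intervalIntegrable,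
    intervalIntegral.integral_congr (g := fun _ => c)
      fun s hs => h.adjoint.inner_add_eq hf hJ hu (hsub hs)]
  simp [hT.ne']

/-- Exponential decay away from both ends of `[0, T]` of a homogeneous adjoint solution without
neutral component, uniformly over trajectories and `T`. -/
lemma IsUniformlyHyperbolic.exists_adjoint_decay (hf : ∀ x ∈ Λ, DifferentiableAt ℝ f x)
    (hf' : ContinuousOn (fderiv ℝ f) Λ) (hΛ : IsUniformlyHyperbolic f Λ Eu Es)
    (hu : IsTrajectory f Λ u) {L : ℝ} (hL : ∀ x ∈ Λ, ‖fderiv ℝ f x‖ ≤ L) :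
    ∃ K μ : ℝ, 0 ≤ K ∧ 0 < μ ∧ ∀ T D : ℝ, 0 ≤ T → ∀ e : ℝ → X,
      (∀ t ∈ Icc 0 T, HasDerivWithinAt e
        (-ContinuousLinearMap.adjoint (fderiv ℝ f (u t)) (e t)) (Icc 0 T) t) →
      ⟪e T, f (u T)⟫_ℝ = 0 → ‖e 0‖ ≤ D → ‖e T‖ ≤ D →
      ∀ t ∈ Icc 0 T, ‖e t‖ ≤ K * D * (Real.exp (-μ * t) + Real.exp (-μ * (T - t))) := by
  obtain ⟨B, hB, hproj⟩ := hΛ.exists_projection_bound hf hf' hL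
  obtain ⟨C, μ, hC, hμ, hrate⟩ := hΛ.rates
  refine ⟨B * C, μ, by positivity, hμ, fun T D hT e he hneu h0 h1 t ht => ?_⟩
  have hD : 0 ≤ D := (norm_nonneg _).trans h0
  have hTt : 0 ≤ T - t := sub_nonneg.2 ht.2
  have heL : ∀ s ∈ Icc 0 t, HasDerivWithinAt e
      (-ContinuousLinearMap.adjoint (fderiv ℝ f (u s)) (e s)) (Icc 0 t) s := fun s hs =>
    (he s ⟨hs.1, hs.2.trans ht.2⟩).mono (Icc_subset_Icc_right ht.2)
  have heR : ∀ s ∈ Icc 0 (T - t), HasDerivWithinAt (fun s => e (t + s))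
      (-ContinuousLinearMap.adjoint (fderiv ℝ f (u (t + s))) (e (t + s))) (Icc 0 (T - t)) s :=
    fun s hs => by
      have d : HasDerivWithinAt (fun s : ℝ => t + s) 1 (Icc 0 (T - t)) s :=
        ((hasDerivAt_id s).const_add t).hasDerivWithinAt
      simpa using! (he (t + s) ⟨by linarith [ht.1, hs.1], by linarith [hs.2]⟩).scomp s d
        (fun r hr => ⟨by linarith [ht.1, hr.1], by linarith [hr.2]⟩)
  have htraj := hu.shift ht.1
  obtain ⟨a, ha, k, c, hc, hdec⟩ := hΛ.exists_decomposition (hu t ht.1).1 (e t)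
  have hp := hproj _ (hu t ht.1).1 a ha k c hc
  rw [← hdec] at hp
  -- The velocity is a tangent solution, so this pairing keeps its zero value from time `T`.
  have hek : ⟪e t, f (u t)⟫_ℝ = 0 := by
    have := IsTangentSolution.inner_eq hTt heR (htraj.isTangentSolution_velocity hf 1 _)
    simpa [hneu] using this.symm
  have hea : ⟪e t, a⟫_ℝ ≤ D * (C * Real.exp (-μ * t) * ‖a‖) := by
    obtain ⟨v, hvt, hv⟩ := hu.exists_tangent_terminal hf' hL ht.1 a
    have r := (hrate u hu t ht.1 v hv).2
      ((hΛ.unstable_invariant u hu t ht.1 v hv).2 (by rwa [hvt]))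
    have := IsTangentSolution.inner_eq ht.1 heL hv
    rw [hvt] at this r
    rw [this]
    exact (real_inner_le_norm _ _).trans (mul_le_mul h0 r (norm_nonneg _) hD)
  have hec : ⟪e t, c⟫_ℝ ≤ D * (C * Real.exp (-μ * (T - t)) * ‖c‖) := by
    obtain ⟨v, hv0, hv⟩ := htraj.exists_tangent hf' hL hTt c
    have r := (hrate _ htraj _ hTt v hv).1 (by simpa [hv0] using hc)
    have := IsTangentSolution.inner_eq hTt heR hv
    simp only [hv0, add_zero, add_sub_cancel] at this
    rw [hv0] at r
    rw [← this]
    exact (real_inner_le_norm _ _).trans (mul_le_mul h1 r (norm_nonneg _) hD)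
  have hsq : ‖e t‖ * ‖e t‖ = ⟪e t, a⟫_ℝ + ⟪e t, c⟫_ℝ := by
    rw [← real_inner_self_eq_norm_mul_norm]
    nth_rewrite 2 [hdec]
    rw [inner_add_right, inner_add_right, inner_smul_right, hek]
    ring
  set p := Real.exp (-μ * t) with hpdef
  set q := Real.exp (-μ * (T - t)) with hqdef
  have hp0 : 0 < p := Real.exp_pos _
  have hq0 : 0 < q := Real.exp_pos _
  -- The estimate below is quadratic in `‖e t‖`; one factor is divided out when it is nonzero.
  rcases (norm_nonneg (e t)).eq_or_lt with hz | hz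
  · rw [← hz]; positivity
  refine le_of_mul_le_mul_right ?_ hz
  calc ‖e t‖ * ‖e t‖ ≤ D * (C * p * ‖a‖) + D * (C * q * ‖c‖) := by
        rw [hsq]; exact add_le_add hea hec
    _ ≤ D * C * (p + q) * (‖a‖ + ‖c‖) := by
        have : 0 ≤ D * C * (q * ‖a‖ + p * ‖c‖) := by positivity
        linarith
    _ ≤ D * C * (p + q) * (B * ‖e t‖) := by gcongr
    _ = B * C * D * (p + q) * ‖e t‖ := by ring

end AdjointError

/-! ### The uniform `H¹` bound. -/

theorem mainTheorem6 {X : Type*} [NormedAddCommGroup X] [InnerProductSpace ℝ X]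
    [CompleteSpace X] [FiniteDimensional ℝ X]
    (f : X → X) (J : X → ℝ) (Λ : Set X) (Eu Es : X → Submodule ℝ X)
    (hf : ∀ x ∈ Λ, DifferentiableAt ℝ f x) (hf' : ContinuousOn (fderiv ℝ f) Λ)
    (hJ : ∀ x ∈ Λ, DifferentiableAt ℝ J x) (hJ' : ContinuousOn (fun x => ∇ J x) Λ)
    (hΛ : IsUniformlyHyperbolic f Λ Eu Es)
    (u : ℝ → X) (hu : IsTrajectory f Λ u)
    (Jbar : ℝ)
    (hJbar : Tendsto (fun T : ℝ => (1 / T) * ∫ t in (0 : ℝ)..T, J (u t)) atTop (𝓝 Jbar))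
    (ψinf : ℝ → X) (hψinf : IsAdjointShadowingDirection f J Eu Es u ψinf)
    (δ : ℝ) (ψ : ℝ → ℝ → X) (hψ : IsFiniteTimeAdjointFamily f J Jbar u δ ψ) :
    ∃ M : ℝ, 0 < M ∧
      (∀ T : ℝ, 0 < T → h1NormSq T (fun t => ψ T t - ψinf t) < ENNReal.ofReal M) ∧
      limsup (fun T : ℝ => h1Norm T (fun t => ψ T t - ψinf t)) atTop < ⊤ := by
  obtain ⟨L, hL⟩ := hΛ.isCompact.exists_bound_of_continuousOn hf'
  have hL0 : 0 ≤ L := (norm_nonneg _).trans (hL _ (hu 0 self_mem_Ici).1)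
  obtain ⟨K, μ, hK, hμ, hdecay⟩ := hΛ.exists_adjoint_decay hf hf' hu hL
  obtain ⟨B, hB⟩ := hψinf.bounded
  set N := K * (δ + B) with hN
  have key : ∀ T : ℝ, 0 < T → h1NormSq T (fun t => ψ T t - ψinf t) ≤
      ENNReal.ofReal (2 * N ^ 2 / μ) + ENNReal.ofReal (2 * (L * N) ^ 2 / μ) := by
    intro T hT
    have he : ∀ t ∈ Icc 0 T, HasDerivWithinAt (fun t => ψ T t - ψinf t)
        (-ContinuousLinearMap.adjoint (fderiv ℝ f (u t)) (ψ T t - ψinf t)) (Icc 0 T) t := by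
      intro t ht
      have h2 := HasDerivWithinAt.mono (s := Icc 0 T)
        (hψinf.adjoint.hasDerivWithinAt (t := t) ht.1) Icc_subset_Ici_self
      convert! ((hψ.adjoint T hT).hasDerivWithinAt ht).sub h2 using 1
      rw [map_sub]
      abel
    -- Both adjoint solutions satisfy `⟪·, f⟫ + J = Jbar` at time `T`.
    have hneu : ⟪ψ T T - ψinf T, f (u T)⟫_ℝ = 0 := by
      rw [inner_sub_left, hψ.terminal T hT, ← hψinf.inner_add_eq hf hJ hu hJbar hT.le]
      ring
    have hd := hdecay T (δ + B) hT.le _ he hneu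
      ((norm_sub_le _ _).trans (add_le_add (hψ.initial_bound T hT).le (hB 0 self_mem_Ici)))
      ((norm_sub_le _ _).trans (add_le_add (hψ.terminal_bound T hT).le (hB T hT.le)))
    refine add_le_add (setLIntegral_enorm_sq_le_of_exp_decay hT.le hμ hd)
      (setLIntegral_enorm_sq_le_of_exp_decay hT.le hμ fun t ht => ?_)
    rw [(he t ht).derivWithin (uniqueDiffOn_Icc hT t ht), norm_neg, mul_assoc]
    refine (ContinuousLinearMap.le_opNorm _ _).trans
      (mul_le_mul ?_ (hd t ht) (norm_nonneg _) hL0)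
    rw [LinearIsometryEquiv.norm_map]
    exact hL _ (hu t ht.1).1
  -- The added `1` makes the inequality strict and `M` positive even when `N = 0`.
  have hM : ∀ T : ℝ, 0 < T → h1NormSq T (fun t => ψ T t - ψinf t) <
      ENNReal.ofReal (2 * N ^ 2 / μ + 2 * (L * N) ^ 2 / μ + 1) := by
    intro T hT
    refine (key T hT).trans_lt ?_
    rw [← ENNReal.ofReal_add (by positivity) (by positivity)]
    exact (ENNReal.ofReal_lt_ofReal_iff (by positivity)).2 (by linarith)
  refine ⟨_, by positivity, hM, ?_⟩
  refine (limsup_le_of_le (a := ENNReal.ofReal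
    (2 * N ^ 2 / μ + 2 * (L * N) ^ 2 / μ + 1) ^ (1 / 2 : ℝ)) (by isBoundedDefault) ?_).trans_lt
    (ENNReal.rpow_lt_top_of_nonneg (by norm_num) ENNReal.ofReal_ne_top)
  filter_upwards [eventually_gt_atTop (0 : ℝ)] with T hT
  exact ENNReal.rpow_le_rpow (hM T hT).le (by norm_num)
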